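/- Let $G$ be a finite simple graph with adjacency matrix $A=\sum_r\theta_rE_r$, where the $\theta_r$ are the distinct eigenvalues of $A$ and $E_r$ is the orthogonal projection onto the $\theta_r$-eigenspace; write $e_v$ for the characteristic vector of a vertex $v$. Vertices $i,j$ are strongly cospectral if for every $r$ one has $E_re_i=E_re_j$ or $E_re_i=-E_re_j$, and the eigenvalue support of $i$ is $\Phi_i=\{\theta_r : E_re_i\neq 0\}$. Let $i$ and $j$ be strongly cospectral vertices of $G$, and let $i'\neq j$ be a neighbour of $i$ and $j'\neq i$ a neighbour of $j$ (possibly $i'=j'$) such that $ii'$ and $jj'$ are cut-edges of $G$, and the removal of either one of these two edges leaves $i$ and $j$ in different connected components. Then $\Phi_i$ has at least two elements, and $$\min\{|\theta-\tau| : \theta,\tau\in\Phi_i,\ \theta\neq\tau\}\le\sqrt2 .$$ If moreover $G$ is connected, then equality holds if and only if $G$ is isomorphic to the path $P_3$ on three vertices. -/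

import Mathlib

noncomputable section

namespace GraphSpectrum

variable {V : Type*} [Fintype V] [DecidableEq V]

/-- The adjacency matrix of `G` as a linear operator on the Euclidean space `ℝ^V`. -/
def adjOp (G : SimpleGraph V) [DecidableRel G.Adj] :
    EuclideanSpace ℝ V →ₗ[ℝ] EuclideanSpace ℝ V :=
  Matrix.toEuclideanLin (G.adjMatrix ℝ)

/-- The set `Φ(G)` of (distinct) eigenvalues of the adjacency matrix of `G`. -/
def eigenvalues (G : SimpleGraph V) [DecidableRel G.Adj] : Set ℝ :=
  {θ | Module.End.HasEigenvalue (adjOp G) θ}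

/-- The eigenprojector `E_θ` in the spectral decomposition of the adjacency matrix: the orthogonal
projection onto the `θ`-eigenspace. -/
def eigenprojector (G : SimpleGraph V) [DecidableRel G.Adj] (θ : ℝ) :
    EuclideanSpace ℝ V →L[ℝ] EuclideanSpace ℝ V :=
  (Module.End.eigenspace (adjOp G) θ).starProjection

/-- The characteristic vector of a vertex. -/
def vertexVector (i : V) : EuclideanSpace ℝ V :=
  EuclideanSpace.single i 1

/-- `i` and `j` are strongly cospectral: `E_θ e_i = ± E_θ e_j` for every eigenvalue `θ`,
where the sign may depend on `θ`. -/
def StronglyCospectral (G : SimpleGraph V) [DecidableRel G.Adj] (i j : V) : Prop :=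
  ∀ θ ∈ eigenvalues G,
    eigenprojector G θ (vertexVector i) = eigenprojector G θ (vertexVector j) ∨
      eigenprojector G θ (vertexVector i) = -eigenprojector G θ (vertexVector j)

/-- The eigenvalue support `Φ_i` of the vertex `i`: the eigenvalues `θ` with `E_θ e_i ≠ 0`. -/
def eigenvalueSupport (G : SimpleGraph V) [DecidableRel G.Adj] (i : V) : Set ℝ :=
  {θ | θ ∈ eigenvalues G ∧ eigenprojector G θ (vertexVector i) ≠ 0}

/-- The distances between two distinct elements of `S`. -/
def distinctDistances (S : Set ℝ) : Set ℝ :=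
  {d | ∃ θ ∈ S, ∃ τ ∈ S, θ ≠ τ ∧ d = |θ - τ|}

/-- The edge `ab` is a cut-edge of `G` whose removal leaves `i` and `j` in different
connected components. -/
def CutEdgeSeparating {V : Type*} (G : SimpleGraph V) (a b i j : V) : Prop :=
  G.Adj a b ∧ G.IsBridge s(a, b) ∧ ¬ (G.deleteEdges {s(a, b)}).Reachable i j

end GraphSpectrum

end

/-! Expand in an orthonormal eigenbasis. Strong cospectrality splits the indices supporting `i` into
symmetric ones `S` and antisymmetric ones `T`, and e_i has components (e_i + e_j)/2 and (e_i -
e_j)/2 in their spans. Let X be the diagonal matrix of χi - χj, the indicators of the sides of `i`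
and `j` at their cut-edges. The commutator [A, X] lives on those two edges, so its S × T block, with
entries (θ a - θ b) D a b up to sign, has squared Frobenius norm at most 2. Since X is 1 at `i` and
-1 at `j`, Cauchy-Schwarz gives the block D of X squared norm at least 1. Hence some S-T gap is at
most √2 (`sum_gap_defect_nonpos`, `gap_sq_eq_two_of_two_le`).

If no gap is below √2, every S-T gap equals √2. Second moments then give degree 1 at `i` and θ³ = 2θ
on the support, so A³e_i = 2Ae_i, which forces P₃ when `G` is connected. Conversely, eigenvalues of
P₃ are roots of t³ = 2t, and distinct roots are at least √2 apart. -/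

namespace GraphSpectrum

open Finset

/-! ### Commutators and cut-edges -/

/-- A weighted form of the inequality `‖[A, X]‖² ≤ 2 ‖X‖²` for Frobenius norms, where `X` has
entries `D a b` in an eigenbasis; the second summand is the defect in the Cauchy-Schwarz
inequality bounding `‖X‖` from below. -/
theorem sum_gap_defect_nonpos {ι : Type*} (S T : Finset ι) (θ p q Y Z : ι → ℝ) (D : ι → ι → ℝ)
    (hp : ∑ a ∈ S, p a ^ 2 = 1 / 2) (hq : ∑ b ∈ T, q b ^ 2 = 1 / 2)
    (hpY : ∑ a ∈ S, p a * Y a = 0)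
    (hYZ : ∑ a ∈ S, Y a ^ 2 + ∑ b ∈ T, Z b ^ 2 ≤ 4)
    (hD : ∑ a ∈ S, ∑ b ∈ T, p a * q b * D a b = 1 / 2)
    (hcomm : ∀ a ∈ S, ∀ b ∈ T, (θ a - θ b) * D a b = q b * Y a - p a * Z b) :
    ∑ a ∈ S, ∑ b ∈ T,
      (((θ a - θ b) ^ 2 - 2) * D a b ^ 2 + 2 * (D a b - 2 * (p a * q b)) ^ 2) ≤ 0 := by
  have key : ∀ a ∈ S, ∀ b ∈ T,
      ((θ a - θ b) ^ 2 - 2) * D a b ^ 2 + 2 * (D a b - 2 * (p a * q b)) ^ 2 =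
      Y a ^ 2 * q b ^ 2 + (-2) * ((p a * Y a) * (q b * Z b)) + p a ^ 2 * Z b ^ 2
        + (-8) * (p a * q b * D a b) + 8 * (p a ^ 2 * q b ^ 2) := by
    intro a ha b hb
    have h := hcomm a ha b hb
    -- The factor is the sum of the two sides of `h`, so this subtracts their squares.
    linear_combination ((θ a - θ b) * D a b + (q b * Y a - p a * Z b)) * h
  rw [Finset.sum_congr rfl fun a ha => Finset.sum_congr rfl (key a ha)]
  simp only [Finset.sum_add_distrib, ← Finset.mul_sum, ← Finset.sum_mul, hp, hq, hpY, hD]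
  linarith

/-- The commutator of the adjacency matrix with the indicator of one side of a cut-edge, evaluated
on two eigenvectors. -/
theorem eigenvalue_sub_mul_sum_side {V : Type*} [Fintype V] [DecidableEq V] (G : SimpleGraph V)
    [DecidableRel G.Adj] {a b : V} (hab : G.Adj a b)
    (hbr : ¬ (G.deleteEdges {s(a, b)}).Reachable a b) (χ : V → ℝ)
    (hχ : ∀ v, ((G.deleteEdges {s(a, b)}).Reachable a v ∧ χ v = 1) ∨
      (¬ (G.deleteEdges {s(a, b)}).Reachable a v ∧ χ v = 0))
    {θ τ : ℝ} {y z : V → ℝ} (hy : ∀ u, ∑ v, G.adjMatrix ℝ u v * y v = θ * y u)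
    (hz : ∀ u, ∑ v, G.adjMatrix ℝ u v * z v = τ * z u) :
    (θ - τ) * ∑ v, χ v * y v * z v = y b * z a - y a * z b := by
  have hne : a ≠ b := hab.ne
  have hχa : χ a = 1 := by
    rcases hχ a with h | h
    · exact h.2
    · exact absurd (SimpleGraph.Reachable.refl a) h.1
  have hχb : χ b = 0 := by
    rcases hχ b with h | h
    · exact absurd h.1 hbr
    · exact h.2
  -- Up to sign these are the entries of [A, diag χ]: `ab` is the only edge along which χ changes.
  have hedge : ∀ v u, G.adjMatrix ℝ v u * (χ v - χ u) =
      (if v = a then (if u = b then 1 else 0) else 0) -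
      (if v = b then (if u = a then 1 else 0) else 0) := by
    intro v u
    by_cases hadj : G.Adj v u
    · by_cases he : s(v, u) = s(a, b)
      · rcases Sym2.eq_iff.1 he with ⟨rfl, rfl⟩ | ⟨rfl, rfl⟩
        · simp [hadj, hχa, hχb, hne]
        · simp [hadj, hχa, hχb, hne]
      · have hadj' : (G.deleteEdges {s(a, b)}).Adj v u := by
          rw [SimpleGraph.deleteEdges_adj]
          exact ⟨hadj, he⟩
        have hiff : (G.deleteEdges {s(a, b)}).Reachable a v ↔
            (G.deleteEdges {s(a, b)}).Reachable a u :=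
          ⟨fun h => h.trans hadj'.reachable, fun h => h.trans hadj'.symm.reachable⟩
        have h0 : χ v = χ u := by
          rcases hχ v with h | h <;> rcases hχ u with h' | h'
          · rw [h.2, h'.2]
          · exact absurd (hiff.1 h.1) h'.1
          · exact absurd (hiff.2 h'.1) h.1
          · rw [h.2, h'.2]
        rw [Sym2.eq_iff, not_or] at he
        rw [h0, sub_self, mul_zero]
        split_ifs <;> grind
    · have h1 : ¬ (v = a ∧ u = b) := by rintro ⟨rfl, rfl⟩; exact hadj hab
      have h2 : ¬ (v = b ∧ u = a) := by rintro ⟨rfl, rfl⟩; exact hadj hab.symm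
      rw [SimpleGraph.adjMatrix_apply, if_neg hadj]
      split_ifs <;> grind
  have h1 : θ * ∑ v, χ v * y v * z v = ∑ v, ∑ u, G.adjMatrix ℝ v u * χ v * (y u * z v) := by
    rw [Finset.mul_sum]
    refine Finset.sum_congr rfl fun v _ => ?_
    rw [show θ * (χ v * y v * z v) = χ v * z v * (θ * y v) by ring, ← hy v, Finset.mul_sum]
    exact Finset.sum_congr rfl fun u _ => by ring
  have h2 : τ * ∑ v, χ v * y v * z v = ∑ v, ∑ u, G.adjMatrix ℝ v u * χ u * (y u * z v) := by
    rw [Finset.sum_comm, Finset.mul_sum]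
    refine Finset.sum_congr rfl fun u _ => ?_
    rw [show τ * (χ u * y u * z u) = χ u * y u * (τ * z u) by ring, ← hz u, Finset.mul_sum]
    refine Finset.sum_congr rfl fun v _ => ?_
    rw [(G.isSymm_adjMatrix (α := ℝ)).apply]
    ring
  rw [sub_mul, h1, h2, ← Finset.sum_sub_distrib]
  have h3 : ∀ v, (∑ u, G.adjMatrix ℝ v u * χ v * (y u * z v)) -
      ∑ u, G.adjMatrix ℝ v u * χ u * (y u * z v) =
      ∑ u, ((if v = a then (if u = b then 1 else 0) else 0) -
      (if v = b then (if u = a then 1 else 0) else 0)) * (y u * z v) := by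
    intro v
    rw [← Finset.sum_sub_distrib]
    refine Finset.sum_congr rfl fun u _ => ?_
    rw [← hedge]
    ring
  simp only [h3, sub_mul, Finset.sum_sub_distrib]
  congr 1 <;> simp [ite_mul, Finset.sum_ite_eq']

/-- If one sign were missing, ∑ x a i * x a j = 0 would equal ± ∑ (x a i)² = ±1. -/
theorem exists_symmetric_antisymmetric {V ι : Type*} [DecidableEq V] [Fintype ι]
    {i j : V} {x : ι → V → ℝ} (hij : i ≠ j)
    (horth : ∀ u v, ∑ a, x a u * x a v = if u = v then 1 else 0)
    (hpm : ∀ a, x a i = x a j ∨ x a i = -x a j) :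
    (∃ a, x a i = x a j ∧ x a i ≠ 0) ∧ ∃ b, x b i = -x b j ∧ x b i ≠ 0 := by
  have h1 := horth i i
  have h2 := horth i j
  rw [if_pos rfl] at h1
  rw [if_neg hij] at h2
  constructor
  · by_contra! h
    have : ∀ a, x a i * x a i = -(x a i * x a j) := by
      intro a
      rcases hpm a with h' | h'
      · simp [h a h']
      · rw [h']; ring
    simp [this, Finset.sum_neg_distrib, h2] at h1
  · by_contra! h
    have : ∀ a, x a i * x a i = x a i * x a j := by
      intro a
      rcases hpm a with h' | h'
      · rw [h']
      · simp [h a h']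
    simp [this, h2] at h1

/-! ### The gap inequality and its equality case -/

section Eigenbasis

variable {V ι : Type*} [Fintype V] [DecidableEq V] [Fintype ι] {G : SimpleGraph V}
  [DecidableRel G.Adj] {i j i' j' : V} {x : ι → V → ℝ} {θ : ι → ℝ}

/-- If all gaps between eigenvalues in the symmetric and the antisymmetric part of the support
are at least `√2`, then they are all equal to `√2`. -/
theorem gap_sq_eq_two_of_two_le
    (horth : ∀ u v, ∑ a, x a u * x a v = if u = v then 1 else 0)
    (heig : ∀ a u, ∑ v, G.adjMatrix ℝ u v * x a v = θ a * x a u)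
    (hpm : ∀ a, x a i = x a j ∨ x a i = -x a j)
    (hi' : i' ≠ j) (hj' : j' ≠ i)
    (hi : CutEdgeSeparating G i i' i j) (hj : CutEdgeSeparating G j j' i j)
    (hgap : ∀ a b, x a i = x a j → x a i ≠ 0 → x b i = -x b j → x b i ≠ 0 →
      2 ≤ (θ a - θ b) ^ 2) :
    ∀ a b, x a i = x a j → x a i ≠ 0 → x b i = -x b j → x b i ≠ 0 → (θ a - θ b) ^ 2 = 2 := by
  classical
  have hij : i ≠ j := by
    rintro rfl
    exact hi.2.2 (SimpleGraph.Reachable.refl _)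
  have hii' : i ≠ i' := hi.1.ne
  have hjj' : j ≠ j' := hj.1.ne
  set S : Finset ι := univ.filter fun a => x a i = x a j ∧ x a i ≠ 0 with hS
  set T : Finset ι := univ.filter fun a => x a i = -x a j ∧ x a i ≠ 0 with hT
  have memS : ∀ a, a ∈ S ↔ x a i = x a j ∧ x a i ≠ 0 := fun a => by simp [hS]
  have memT : ∀ a, a ∈ T ↔ x a i = -x a j ∧ x a i ≠ 0 := fun a => by simp [hT]
  -- The weight (x a i + x a j)/2 is `x a i` on `S` and vanishes elsewhere, so sums over `S` become
  -- full sums, to which `horth` applies.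
  have sumS : ∀ f : ι → ℝ, ∑ a ∈ S, x a i * f a = ∑ a, (x a i + x a j) / 2 * f a := by
    intro f
    rw [hS, Finset.sum_filter]
    refine Finset.sum_congr rfl fun a _ => ?_
    split_ifs with h
    · rw [← h.1]; ring
    · have : x a i + x a j = 0 := by rcases hpm a with h' | h' <;> grind
      rw [this]; ring
  have sumT : ∀ f : ι → ℝ, ∑ a ∈ T, x a i * f a = ∑ a, (x a i - x a j) / 2 * f a := by
    intro f
    rw [hT, Finset.sum_filter]
    refine Finset.sum_congr rfl fun a _ => ?_
    split_ifs with h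
    · rw [show x a j = -x a i by rw [h.1, neg_neg]]; ring
    · have : x a i - x a j = 0 := by rcases hpm a with h' | h' <;> grind
      rw [this]; ring
  have sumSv : ∀ v, ∑ a ∈ S, x a i * x a v =
      ((if i = v then 1 else 0) + (if j = v then 1 else 0)) / 2 := by
    intro v
    rw [sumS, ← horth i v, ← horth j v, ← Finset.sum_add_distrib, Finset.sum_div]
    exact Finset.sum_congr rfl fun a _ => by ring
  have sumTv : ∀ v, ∑ a ∈ T, x a i * x a v =
      ((if i = v then 1 else 0) - (if j = v then 1 else 0)) / 2 := by
    intro v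
    rw [sumT, ← horth i v, ← horth j v, ← Finset.sum_sub_distrib, Finset.sum_div]
    exact Finset.sum_congr rfl fun a _ => by ring
  set Hi : V → Prop := fun v => (G.deleteEdges {s(i, i')}).Reachable i v with hHi
  set Hj : V → Prop := fun v => (G.deleteEdges {s(j, j')}).Reachable j v with hHj
  set χi : V → ℝ := fun v => if Hi v then 1 else 0 with hχi
  set χj : V → ℝ := fun v => if Hj v then 1 else 0 with hχj
  set D : ι → ι → ℝ := fun a b => ∑ v, (χi v - χj v) * x a v * x b v with hD
  have hcomm : ∀ a ∈ S, ∀ b ∈ T, (θ a - θ b) * D a b =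
      x b i * (x a i' + x a j') - x a i * (x b i' - x b j') := by
    intro a ha b hb
    have e1 := eigenvalue_sub_mul_sum_side G hi.1 (SimpleGraph.isBridge_iff.1 hi.2.1) χi
      (fun v => by by_cases h : Hi v <;> simp [hχi, h, ← hHi]) (heig a) (heig b)
    have e2 := eigenvalue_sub_mul_sum_side G hj.1 (SimpleGraph.isBridge_iff.1 hj.2.1) χj
      (fun v => by by_cases h : Hj v <;> simp [hχj, h, ← hHj]) (heig a) (heig b)
    have e3 : D a b = ∑ v, χi v * x a v * x b v - ∑ v, χj v * x a v * x b v := by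
      rw [hD, ← Finset.sum_sub_distrib]
      exact Finset.sum_congr rfl fun v _ => by ring
    have ha1 := ((memS a).1 ha).1
    have hb1 : x b j = -x b i := by rw [((memT b).1 hb).1, neg_neg]
    rw [e3, mul_sub, e1, e2, ← ha1, hb1]
    ring
  have hχii : χi i = 1 := if_pos (SimpleGraph.Reachable.refl _)
  have hχjj : χj j = 1 := if_pos (SimpleGraph.Reachable.refl _)
  have hχij : χi j = 0 := if_neg hi.2.2
  have hχji : χj i = 0 := if_neg fun h => hj.2.2 h.symm
  -- The sum is the X-pairing of (e_i + e_j)/2 with (e_i - e_j)/2, that is (X_ii - X_jj)/4 = (1 +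
  -- 1)/4.
  have hDsum : ∑ a ∈ S, ∑ b ∈ T, x a i * x b i * D a b = 1 / 2 := by
    have : ∀ a ∈ S, ∑ b ∈ T, x a i * x b i * D a b =
        x a i * ((1 / 2) * (x a i + x a j)) := by
      intro a _
      have h1 : ∀ b ∈ T, x a i * x b i * D a b =
          ∑ v, x a i * (χi v - χj v) * x a v * (x b i * x b v) := by
        intro b _
        rw [hD, Finset.mul_sum]
        exact Finset.sum_congr rfl fun v _ => by ring
      rw [Finset.sum_congr rfl h1, Finset.sum_comm]
      simp only [← Finset.mul_sum, sumTv, sub_div, mul_sub, Finset.sum_sub_distrib, ite_div,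
        zero_div, mul_ite, mul_zero, Finset.sum_ite_eq, Finset.mem_univ, if_true]
      rw [hχii, hχjj, hχij, hχji]
      ring
    rw [Finset.sum_congr rfl this]
    have h2 : ∀ a ∈ S, x a i * ((1 / 2) * (x a i + x a j)) =
        (1 / 2) * (x a i * x a i + x a i * x a j) := fun a _ => by ring
    rw [Finset.sum_congr rfl h2, ← Finset.mul_sum, Finset.sum_add_distrib, sumSv, sumSv]
    simp [hij, hij.symm]
    norm_num
  -- Both squares are at most 2 (x i')² + 2 (x j')², whose sum over the whole basis is 4; this
  -- covers i' = j'.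
  have hYZ : ∑ a ∈ S, (x a i' + x a j') ^ 2 + ∑ b ∈ T, (x b i' - x b j') ^ 2 ≤ 4 := by
    have hdisj : Disjoint S T := by
      rw [Finset.disjoint_left]
      intro a ha hb
      have h1 := (memS a).1 ha
      have h2 := (memT a).1 hb
      exact h1.2 (by linarith [h1.1, h2.1])
    have h1 : ∑ a ∈ S, (x a i' + x a j') ^ 2 ≤
        ∑ a ∈ S, (2 * (x a i' * x a i') + 2 * (x a j' * x a j')) :=
      Finset.sum_le_sum fun a _ => by nlinarith [sq_nonneg (x a i' - x a j')]
    have h2 : ∑ a ∈ T, (x a i' - x a j') ^ 2 ≤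
        ∑ a ∈ T, (2 * (x a i' * x a i') + 2 * (x a j' * x a j')) :=
      Finset.sum_le_sum fun a _ => by nlinarith [sq_nonneg (x a i' + x a j')]
    have h3 : ∑ a ∈ S ∪ T, (2 * (x a i' * x a i') + 2 * (x a j' * x a j')) ≤
        ∑ a, (2 * (x a i' * x a i') + 2 * (x a j' * x a j')) :=
      Finset.sum_le_sum_of_subset_of_nonneg (Finset.subset_univ _) fun a _ _ => by
        nlinarith [mul_self_nonneg (x a i'), mul_self_nonneg (x a j')]
    rw [Finset.sum_union hdisj] at h3
    rw [Finset.sum_add_distrib (s := univ), ← Finset.mul_sum, ← Finset.mul_sum, horth, horth] at h3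
    norm_num at h3
    linarith
  have main := sum_gap_defect_nonpos S T θ (fun a => x a i) (fun a => x a i)
    (fun a => x a i' + x a j') (fun a => x a i' - x a j') D
    (by simp only [sq]; rw [sumSv]; simp [hij.symm])
    (by simp only [sq]; rw [sumTv]; simp [hij.symm])
    (by simp only [mul_add]; rw [Finset.sum_add_distrib, sumSv, sumSv]
        simp [hii', hjj', hi'.symm, hj'.symm])
    hYZ hDsum hcomm
  have hnn : ∀ a ∈ S, ∀ b ∈ T, 0 ≤
      ((θ a - θ b) ^ 2 - 2) * D a b ^ 2 + 2 * (D a b - 2 * (x a i * x b i)) ^ 2 := by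
    intro a ha b hb
    obtain ⟨ha1, ha2⟩ := (memS a).1 ha
    obtain ⟨hb1, hb2⟩ := (memT b).1 hb
    have := sub_nonneg.2 (hgap a b ha1 ha2 hb1 hb2)
    positivity
  intro a b ha1 ha2 hb1 hb2
  have ha : a ∈ S := (memS a).2 ⟨ha1, ha2⟩
  have hb : b ∈ T := (memT b).2 ⟨hb1, hb2⟩
  have h0 := le_antisymm main (Finset.sum_nonneg fun a ha => Finset.sum_nonneg (hnn a ha))
  have h1 := (Finset.sum_eq_zero_iff_of_nonneg
    fun a ha => Finset.sum_nonneg (hnn a ha)).1 h0 a ha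
  have h2 := (Finset.sum_eq_zero_iff_of_nonneg (hnn a ha)).1 h1 b hb
  have h3 : 0 ≤ ((θ a - θ b) ^ 2 - 2) * D a b ^ 2 :=
    mul_nonneg (sub_nonneg.2 (hgap a b ha1 ha2 hb1 hb2)) (sq_nonneg _)
  have h4 : (D a b - 2 * (x a i * x b i)) ^ 2 = 0 := by
    nlinarith [sq_nonneg (D a b - 2 * (x a i * x b i))]
  have h5 : ((θ a - θ b) ^ 2 - 2) * D a b ^ 2 = 0 := by
    linarith
  -- The vanishing Cauchy-Schwarz defect makes D proportional to the nonzero products p q, so no gap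
  -- can escape through D = 0.
  have h6 : D a b ≠ 0 := by
    have : D a b = 2 * (x a i * x b i) := sub_eq_zero.1 (pow_eq_zero_iff (two_ne_zero) |>.1 h4)
    rw [this]
    exact mul_ne_zero two_ne_zero (mul_ne_zero ha2 hb2)
  rcases mul_eq_zero.1 h5 with h | h
  · linarith
  · exact absurd (pow_eq_zero_iff two_ne_zero |>.1 h) h6

theorem sum_eigenvalue_pow_mul
    (horth : ∀ u v, ∑ a, x a u * x a v = if u = v then 1 else 0)
    (heig : ∀ a u, ∑ v, G.adjMatrix ℝ u v * x a v = θ a * x a u) (k : ℕ) (u v : V) :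
    ∑ a, θ a ^ k * (x a u * x a v) = (G.adjMatrix ℝ ^ k) u v := by
  induction k generalizing u with
  | zero => simp [horth, Matrix.one_apply]
  | succ k ih =>
    rw [pow_succ', Matrix.mul_apply]
    simp only [← ih, Finset.mul_sum]
    rw [Finset.sum_comm]
    refine Finset.sum_congr rfl fun a _ => ?_
    rw [show θ a ^ (k + 1) * (x a u * x a v) = θ a ^ k * x a v * (θ a * x a u) by ring, ← heig,
      Finset.mul_sum]
    exact Finset.sum_congr rfl fun w _ => by ring

/-- Average (θ b - θ a)² = 2 against the spectral weights of e_i ∓ e_j. The first moments vanish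
because A_ii = A_ij = 0, leaving linear relations between (A²)_ii, (A²)_ij and the squared
eigenvalues. -/
theorem degree_eq_one_and_cube_of_gap_sq_eq_two (hij : i ≠ j) (hadj : ¬ G.Adj i j)
    (horth : ∀ u v, ∑ a, x a u * x a v = if u = v then 1 else 0)
    (heig : ∀ a u, ∑ v, G.adjMatrix ℝ u v * x a v = θ a * x a u)
    (hpm : ∀ a, x a i = x a j ∨ x a i = -x a j)
    (hgap : ∀ a b, x a i = x a j → x a i ≠ 0 → x b i = -x b j → x b i ≠ 0 →
      (θ a - θ b) ^ 2 = 2) :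
    G.degree i = 1 ∧ ∀ a, x a i ≠ 0 → θ a ^ 3 = 2 * θ a := by
  have hA1 : ∑ a, θ a * (x a i * x a i) = 0 := by
    simpa using sum_eigenvalue_pow_mul horth heig 1 i i
  have hA2 : ∑ a, θ a * (x a i * x a j) = 0 := by
    simpa [hadj] using sum_eigenvalue_pow_mul horth heig 1 i j
  have h1 := horth i i
  have h2 := horth i j
  rw [if_pos rfl] at h1
  rw [if_neg hij] at h2
  have hdeg : ∑ a, θ a ^ 2 * (x a i * x a i) = G.degree i := by
    rw [sum_eigenvalue_pow_mul horth heig, sq, SimpleGraph.adjMatrix_mul_self_apply_self]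
  set d₁ := ∑ a, θ a ^ 2 * (x a i * x a i) with hd₁
  set d₂ := ∑ a, θ a ^ 2 * (x a i * x a j) with hd₂
  have hexpand : ∀ (c s : ℝ), ∑ a, (θ a - c) ^ 2 * (x a i * x a i + s * (x a i * x a j)) =
      d₁ + s * d₂ + c ^ 2 := by
    intro c s
    have : ∀ a, (θ a - c) ^ 2 * (x a i * x a i + s * (x a i * x a j)) =
        θ a ^ 2 * (x a i * x a i) + s * (θ a ^ 2 * (x a i * x a j))
        + (-2 * c) * (θ a * (x a i * x a i)) + (-2 * c * s) * (θ a * (x a i * x a j))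
        + c ^ 2 * (x a i * x a i) + c ^ 2 * s * (x a i * x a j) := fun a => by ring
    simp only [this, Finset.sum_add_distrib, ← Finset.mul_sum, hA1, hA2, h1, h2, ← hd₁, ← hd₂]
    ring
  have hS : ∀ a, x a i = x a j → x a i ≠ 0 → d₁ - d₂ + θ a ^ 2 = 2 := by
    intro a ha1 ha2
    have h := hexpand (θ a) (-1)
    have h' : ∀ b, (θ b - θ a) ^ 2 * (x b i * x b i + (-1) * (x b i * x b j)) =
        2 * (x b i * x b i + (-1) * (x b i * x b j)) := by
      intro b
      by_cases hb : x b i = -x b j ∧ x b i ≠ 0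
      · rw [show (θ b - θ a) ^ 2 = (θ a - θ b) ^ 2 by ring, hgap a b ha1 ha2 hb.1 hb.2]
      · have : x b i * x b i + (-1) * (x b i * x b j) = 0 := by
          rcases hpm b with hb' | hb' <;> grind
        rw [this]; ring
    simp only [h', ← Finset.mul_sum, Finset.sum_add_distrib, h1, h2] at h
    linarith
  have hT : ∀ b, x b i = -x b j → x b i ≠ 0 → d₁ + d₂ + θ b ^ 2 = 2 := by
    intro b hb1 hb2
    have h := hexpand (θ b) 1
    have h' : ∀ a, (θ a - θ b) ^ 2 * (x a i * x a i + 1 * (x a i * x a j)) =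
        2 * (x a i * x a i + 1 * (x a i * x a j)) := by
      intro a
      by_cases ha : x a i = x a j ∧ x a i ≠ 0
      · rw [hgap a b ha.1 ha.2 hb1 hb2]
      · have : x a i * x a i + 1 * (x a i * x a j) = 0 := by
          rcases hpm a with ha' | ha' <;> grind
        rw [this]; ring
    simp only [h', ← Finset.mul_sum, Finset.sum_add_distrib, h1, h2] at h
    linarith
  obtain ⟨⟨a₀, ha₀, ha₀'⟩, b₀, hb₀, hb₀'⟩ := exists_symmetric_antisymmetric hij horth hpm
  have hd : d₁ + d₂ = 2 - θ b₀ ^ 2 := by linarith [hT b₀ hb₀ hb₀']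
  have hd' : d₁ - d₂ = 2 - θ a₀ ^ 2 := by linarith [hS a₀ ha₀ ha₀']
  -- By `hS` the square of θ is constant on `S`, so the second moment over `S` is that constant.
  have hsum : d₁ + d₂ = θ a₀ ^ 2 := by
    have h : ∑ a, θ a ^ 2 * (x a i * x a i + 1 * (x a i * x a j)) =
        ∑ a, θ a₀ ^ 2 * (x a i * x a i + 1 * (x a i * x a j)) := by
      refine Finset.sum_congr rfl fun a _ => ?_
      by_cases ha : x a i = x a j ∧ x a i ≠ 0
      · rw [show θ a ^ 2 = θ a₀ ^ 2 by linarith [hS a ha.1 ha.2, hS a₀ ha₀ ha₀']]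
      · have : x a i * x a i + 1 * (x a i * x a j) = 0 := by
          rcases hpm a with ha' | ha' <;> grind
        rw [this]; ring
    have h' := hexpand 0 1
    simp only [sub_zero] at h'
    rw [h', ← Finset.mul_sum, Finset.sum_add_distrib, ← Finset.mul_sum, h1, h2] at h
    linarith
  have hcube : ∀ a b, x a i = x a j → x a i ≠ 0 → x b i = -x b j → x b i ≠ 0 →
      θ a ^ 3 = 2 * θ a ∧ θ b ^ 3 = 2 * θ b := by
    intro a b ha1 ha2 hb1 hb2
    have e1 := hS a ha1 ha2
    have e2 := hT b hb1 hb2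
    have e3 : θ a ^ 2 + θ b ^ 2 = 2 := by linarith
    have e4 : θ a * θ b = 0 := by nlinarith [hgap a b ha1 ha2 hb1 hb2]
    constructor
    · linear_combination θ a * e3 - θ b * e4
    · linear_combination θ b * e3 - θ a * e4
  refine ⟨?_, fun a ha => ?_⟩
  · have : d₁ = 1 := by linarith
    rw [hdeg] at this
    exact_mod_cast this
  · rcases hpm a with h | h
    · exact (hcube a b₀ h ha hb₀ hb₀').1
    · exact (hcube a₀ a ha₀ ha₀' h ha).2

end Eigenbasis

/-! ### Recognising P₃, and its eigenvalues -/

theorem nonempty_iso_pathGraph_three {V : Type*} {G : SimpleGraph V} {i m w : V} (hG : G.Connected)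
    (him : i ≠ m) (hiw : i ≠ w) (hmw : m ≠ w) (hi : ∀ v, G.Adj i v ↔ v = m) (hm : ∀ v, G.Adj m v ↔ v = i ∨ v = w)
    (hw : ∀ v, G.Adj w v ↔ v = m) : Nonempty (G ≃g SimpleGraph.pathGraph 3) := by
  have hall : ∀ v, v = i ∨ v = m ∨ v = w := by
    have hwalk : ∀ v u, G.Walk v u → u = i → v = i ∨ v = m ∨ v = w := by
      intro v u p hu
      induction p with
      | nil => exact Or.inl hu
      | cons h _ ih =>
        rcases ih hu with rfl | rfl | rfl
        · exact Or.inr (Or.inl ((hi _).1 h.symm))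
        · rcases (hm _).1 h.symm with h | h <;> simp [h]
        · exact Or.inr (Or.inl ((hw _).1 h.symm))
    intro v
    obtain ⟨p⟩ := hG.preconnected v i
    exact hwalk v i p rfl
  let f : Fin 3 → V := ![i, m, w]
  have hf : Function.Bijective f := by
    constructor
    · intro a b hab
      fin_cases a <;> fin_cases b <;> simp_all [f]
    · intro v
      rcases hall v with rfl | rfl | rfl
      · exact ⟨0, rfl⟩
      · exact ⟨1, rfl⟩
      · exact ⟨2, rfl⟩
  refine ⟨RelIso.symm ⟨Equiv.ofBijective f hf, ?_⟩⟩
  intro a b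
  fin_cases a <;> fin_cases b <;>
    simp [f, SimpleGraph.pathGraph_adj, hi, hm, hw, him, hiw, hiw.symm, hmw.symm]

/-- With `m` the only neighbour of `i`, (A³)_ui = (A²)_um counts the common neighbours of u and m.
It is 2 for u = m and 0 otherwise, so `m` has degree 2 and its neighbours are leaves. -/
theorem iso_pathGraph_three_of_cube {V : Type*} [Fintype V] [DecidableEq V] {G : SimpleGraph V}
    [DecidableRel G.Adj] {i : V} (hG : G.Connected) (hdeg : G.degree i = 1)
    (hcube : ∀ u, (G.adjMatrix ℝ ^ 3) u i = 2 * G.adjMatrix ℝ u i) :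
    Nonempty (G ≃g SimpleGraph.pathGraph 3) := by
  obtain ⟨m, him, huniq⟩ := (SimpleGraph.degree_eq_one_iff_existsUnique_adj).1 hdeg
  have hi : ∀ v, G.Adj i v ↔ v = m := fun v => ⟨fun h => huniq v h, fun h => h ▸ him⟩
  have hcommon : ∀ u, (((G.neighborFinset u) ∩ (G.neighborFinset m)).card : ℝ) =
      2 * G.adjMatrix ℝ u i := by
    intro u
    have h2 : ∀ v, (G.adjMatrix ℝ ^ 2) v i = G.adjMatrix ℝ v m := by
      intro v
      rw [sq, Matrix.mul_apply, Finset.sum_eq_single m]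
      · simp [him.symm]
      · intro b _ hb
        have : ¬ G.Adj b i := fun h => hb ((hi b).1 h.symm)
        simp [this]
      · simp
    rw [← hcube, pow_succ', Matrix.mul_apply]
    simp only [h2, SimpleGraph.adjMatrix_apply, mul_ite, mul_one, mul_zero]
    rw [← Finset.sum_filter, ← Finset.sum_filter, Finset.sum_const, nsmul_one]
    congr 2
    ext v
    simp [SimpleGraph.adj_comm, and_comm]
  have hm2 : (G.neighborFinset m).card = 2 := by
    have := hcommon m
    rw [Finset.inter_self, SimpleGraph.adjMatrix_apply, if_pos him.symm] at this
    exact_mod_cast this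
  have hempty : ∀ u v, G.Adj v m → G.Adj u v → u = m := by
    intro u v hvm huv
    by_contra hne
    have h := hcommon u
    have hui : ¬ G.Adj u i := fun h => hne ((hi u).1 h.symm)
    rw [SimpleGraph.adjMatrix_apply, if_neg hui, mul_zero, Nat.cast_eq_zero,
      Finset.card_eq_zero] at h
    have : v ∈ G.neighborFinset u ∩ G.neighborFinset m := by simp [huv, hvm.symm]
    rw [h] at this
    simp at this
  have hmem : i ∈ G.neighborFinset m := by simpa using him.symm
  obtain ⟨w, hw⟩ := Finset.card_eq_one.1
    (show ((G.neighborFinset m).erase i).card = 1 by rw [Finset.card_erase_of_mem hmem, hm2])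
  have hwm : w ≠ i ∧ G.Adj m w := by
    have : w ∈ (G.neighborFinset m).erase i := by simp [hw]
    simpa using this
  refine nonempty_iso_pathGraph_three hG him.ne hwm.1.symm hwm.2.ne hi (fun v => ?_) fun v => ?_
  · constructor
    · intro h
      by_cases hv : v = i
      · exact Or.inl hv
      · right
        have : v ∈ (G.neighborFinset m).erase i := by simp [hv, h]
        rwa [hw, Finset.mem_singleton] at this
    · rintro (rfl | rfl)
      · exact him.symm
      · exact hwm.2
  · exact ⟨fun h => hempty v w hwm.2.symm h.symm, fun h => h ▸ hwm.2.symm⟩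

/-- Every eigenvalue of a graph isomorphic to `P₃` satisfies `θ³ = 2θ`. -/
theorem cube_eq_of_iso_pathGraph_three {V : Type*} [Fintype V] {G : SimpleGraph V}
    [DecidableRel G.Adj] (e : G ≃g SimpleGraph.pathGraph 3) {θ : ℝ} {y : V → ℝ}
    (hy : ∀ u, ∑ v, G.adjMatrix ℝ u v * y v = θ * y u) (hne : y ≠ 0) : θ ^ 3 = 2 * θ := by
  classical
  have h : ∀ a : Fin 3, ∑ b, (if (SimpleGraph.pathGraph 3).Adj a b then 1 else 0) * y (e.symm b) =
      θ * y (e.symm a) := by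
    intro a
    rw [← hy, ← Equiv.sum_comp e.symm.toEquiv]
    refine Finset.sum_congr rfl fun b _ => ?_
    rw [SimpleGraph.adjMatrix_apply]
    congr 1
    exact if_congr (e.symm.map_rel_iff (a := a) (b := b)).symm rfl rfl
  have h0 := h 0
  have h1 := h 1
  have h2 := h 2
  simp [Fin.sum_univ_three, SimpleGraph.pathGraph_adj] at h0 h1 h2
  by_contra hθ
  have hz : θ ^ 3 - 2 * θ ≠ 0 := sub_ne_zero.2 hθ
  have key : ∀ a : Fin 3, y (e.symm a) = 0 := by
    have k1 : y (e.symm 1) = 0 := by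
      apply (mul_eq_zero.1 (_ : (θ ^ 3 - 2 * θ) * y (e.symm 1) = 0)).resolve_left hz
      -- Multiplying the middle equation by θ² and eliminating both ends gives θ³ y₁ = 2θ y₁.
      linear_combination -θ ^ 2 * h1 - θ * h0 - θ * h2
    have hθ0 : θ ≠ 0 := by rintro rfl; simp at hz
    intro a
    fin_cases a
    · rw [k1] at h0
      exact (mul_eq_zero.1 h0.symm).resolve_left hθ0
    · exact k1
    · rw [k1] at h2
      exact (mul_eq_zero.1 h2.symm).resolve_left hθ0
  apply hne
  funext v
  simpa using key (e v)

/-! ### From eigenprojectors to an eigenbasis -/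

section Operator

variable {V : Type*} [Fintype V] [DecidableEq V] {G : SimpleGraph V} [DecidableRel G.Adj]

theorem mem_eigenspace_adjOp_iff {θ : ℝ} {y : EuclideanSpace ℝ V} :
    y ∈ Module.End.eigenspace (adjOp G) θ ↔ ∀ u, ∑ v, G.adjMatrix ℝ u v * y v = θ * y u := by
  rw [Module.End.mem_eigenspace_iff, ← (WithLp.ofLp_injective 2).eq_iff, funext_iff]
  rfl

theorem inner_eigenprojector_vertexVector {θ : ℝ} {y : EuclideanSpace ℝ V}
    (hy : y ∈ Module.End.eigenspace (adjOp G) θ) (v : V) :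
    inner ℝ y (eigenprojector G θ (vertexVector v)) = y v := by
  rw [eigenprojector, ← Submodule.inner_starProjection_left_eq_right,
    Submodule.starProjection_eq_self_iff.2 hy, vertexVector]
  simp [EuclideanSpace.inner_single_right]

variable (G) in
theorem exists_eigenbasis : ∃ (b : OrthonormalBasis V ℝ (EuclideanSpace ℝ V)) (θ : V → ℝ),
    ∀ a, b a ∈ Module.End.eigenspace (adjOp G) (θ a) := by
  have hA : (G.adjMatrix ℝ).IsHermitian := G.isSymm_adjMatrix
  refine ⟨hA.eigenvectorBasis, hA.eigenvalues, fun a => ?_⟩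
  rw [mem_eigenspace_adjOp_iff]
  exact fun u => congrFun (hA.mulVec_eigenvectorBasis a) u

theorem sum_orthonormalBasis_mul (b : OrthonormalBasis V ℝ (EuclideanSpace ℝ V)) (u v : V) :
    ∑ a, b a u * b a v = if u = v then 1 else 0 := by
  have := b.sum_inner_mul_inner (EuclideanSpace.single v 1) (EuclideanSpace.single u 1)
  simpa [EuclideanSpace.inner_single_left, EuclideanSpace.inner_single_right, eq_comm, mul_comm] using this

theorem mem_eigenvalueSupport {θ : ℝ} {y : EuclideanSpace ℝ V} {i : V}
    (hy : y ∈ Module.End.eigenspace (adjOp G) θ) (hyi : y i ≠ 0) : θ ∈ eigenvalueSupport G i := by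
  constructor
  · exact Module.End.hasEigenvalue_of_hasEigenvector ⟨hy, fun h => hyi (by simp [h])⟩
  · intro h
    apply hyi
    rw [← inner_eigenprojector_vertexVector hy, h, inner_zero_right]

theorem finite_distinctDistances {S : Set ℝ} (hS : S.Finite) : (distinctDistances S).Finite := by
  refine ((hS.prod hS).image fun p => |p.1 - p.2|).subset ?_
  rintro d ⟨θ, hθ, τ, hτ, -, rfl⟩
  exact ⟨(θ, τ), ⟨hθ, hτ⟩, rfl⟩

theorem finite_eigenvalueSupport (G : SimpleGraph V) [DecidableRel G.Adj] (i : V) :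
    (eigenvalueSupport G i).Finite :=
  (Module.End.finite_hasEigenvalue (adjOp G)).subset fun _ h => h.1

/-- The coordinates at `i` and `j` of an eigenvector agree up to a sign that depends only on the
eigenvalue. -/
theorem StronglyCospectral.apply_eq_or_neg {i j : V} (hij : StronglyCospectral G i j) (θ : ℝ) :
    (∀ y ∈ Module.End.eigenspace (adjOp G) θ, y i = y j) ∨
      ∀ y ∈ Module.End.eigenspace (adjOp G) θ, y i = -y j := by
  by_cases hθ : θ ∈ eigenvalues G
  · refine (hij θ hθ).imp (fun h y hy => ?_) fun h y hy => ?_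
    · rw [← inner_eigenprojector_vertexVector hy, h, inner_eigenprojector_vertexVector hy]
    · rw [← inner_eigenprojector_vertexVector hy, h, inner_neg_right,
        inner_eigenprojector_vertexVector hy]
  · left
    intro y hy
    have : y = 0 := by
      by_contra h
      exact hθ (Module.End.hasEigenvalue_of_hasEigenvector ⟨hy, h⟩)
    simp [this]

end Operator

theorem CutEdgeSeparating.not_adj {V : Type*} {G : SimpleGraph V} {i i' j : V} (hi' : i' ≠ j)
    (h : CutEdgeSeparating G i i' i j) : ¬ G.Adj i j := by
  intro hadj
  apply h.2.2
  refine SimpleGraph.Adj.reachable ?_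
  rw [SimpleGraph.deleteEdges_adj]
  refine ⟨hadj, fun he => ?_⟩
  rcases Sym2.eq_iff.1 (Set.mem_singleton_iff.1 he) with ⟨-, h1⟩ | ⟨h1, h2⟩
  · exact hi' h1.symm
  · exact h.1.ne h1

/-- Distinct roots of `t³ = 2t` are at distance at least `√2`. -/
theorem sqrt_two_le_abs_sub {s t : ℝ} (hs : s ^ 3 = 2 * s) (ht : t ^ 3 = 2 * t) (hne : s ≠ t) :
    √2 ≤ |s - t| := by
  rw [Real.sqrt_le_left (abs_nonneg _), sq_abs]
  have h1 : s = 0 ∨ s ^ 2 = 2 := by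
    rcases eq_or_ne s 0 with h | h
    · exact Or.inl h
    · exact Or.inr (mul_left_cancel₀ h (by linear_combination hs))
  have h2 : t = 0 ∨ t ^ 2 = 2 := by
    rcases eq_or_ne t 0 with h | h
    · exact Or.inl h
    · exact Or.inr (mul_left_cancel₀ h (by linear_combination ht))
  rcases h1 with rfl | h1
  · rcases h2 with rfl | h2
    · exact absurd rfl hne
    · linarith [show (0 - t) ^ 2 = t ^ 2 by ring]
  · rcases h2 with rfl | h2
    · linarith [show (s - 0) ^ 2 = s ^ 2 by ring]
    · have : s + t = 0 := by
        have : (s - t) * (s + t) = 0 := by linear_combination h1 - h2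
        exact (mul_eq_zero.1 this).resolve_left (sub_ne_zero.2 hne)
      nlinarith

end GraphSpectrum

/-! ### The least gap in the support -/

theorem mainTheorem3 {V : Type*} [Fintype V] [DecidableEq V]
    (G : SimpleGraph V) [DecidableRel G.Adj] (i j i' j' : V)
    (hij : GraphSpectrum.StronglyCospectral G i j)
    (hi' : i' ≠ j) (hj' : j' ≠ i)
    (hi : GraphSpectrum.CutEdgeSeparating G i i' i j)
    (hj : GraphSpectrum.CutEdgeSeparating G j j' i j) :
    ∃ d : ℝ,
      IsLeast (GraphSpectrum.distinctDistances (GraphSpectrum.eigenvalueSupport G i)) d ∧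
      d ≤ √2 ∧
      (G.Connected → (d = √2 ↔ Nonempty (G ≃g SimpleGraph.pathGraph 3))) := by
  open GraphSpectrum in
  have hne : i ≠ j := by
    rintro rfl
    exact hi.2.2 (SimpleGraph.Reachable.refl _)
  obtain ⟨b, θ, hb⟩ := exists_eigenbasis G
  have horth := sum_orthonormalBasis_mul b
  have heig : ∀ a u, ∑ v, G.adjMatrix ℝ u v * b a v = θ a * b a u :=
    fun a => mem_eigenspace_adjOp_iff.1 (hb a)
  have hpm : ∀ a, b a i = b a j ∨ b a i = -b a j := fun a =>
    (hij.apply_eq_or_neg (θ a)).imp (fun h => h _ (hb a)) fun h => h _ (hb a)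
  have hdist : ∀ a c, b a i = b a j → b a i ≠ 0 → b c i = -b c j → b c i ≠ 0 →
      |θ a - θ c| ∈ distinctDistances (eigenvalueSupport G i) := by
    intro a c ha ha' hc hc'
    refine ⟨θ a, mem_eigenvalueSupport (hb a) ha', θ c, mem_eigenvalueSupport (hb c) hc',
      fun he => ?_, rfl⟩
    -- Equal eigenvalues would share one sign, making `b a` or `b c` vanish at `i`.
    rcases hij.apply_eq_or_neg (θ a) with h | h
    · have := h _ (he ▸ hb c)
      exact hc' (by linarith)
    · have := h _ (hb a)
      exact ha' (by linarith)
  have hfin := finite_distinctDistances (finite_eigenvalueSupport G i)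
  obtain ⟨⟨a₀, ha₀, ha₀'⟩, c₀, hc₀, hc₀'⟩ := exists_symmetric_antisymmetric hne horth hpm
  obtain ⟨d, hd, hmin⟩ := Set.exists_min_image _ id hfin ⟨_, hdist a₀ c₀ ha₀ ha₀' hc₀ hc₀'⟩
  simp only [id] at hmin
  have hgap_two : √2 ≤ d →
      ∀ a c, b a i = b a j → b a i ≠ 0 → b c i = -b c j → b c i ≠ 0 → (θ a - θ c) ^ 2 = 2 := by
    intro hle
    refine gap_sq_eq_two_of_two_le horth heig hpm hi' hj' hi hj fun a c ha ha' hc hc' => ?_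
    have h := hle.trans (hmin _ (hdist a c ha ha' hc hc'))
    rwa [Real.sqrt_le_left (abs_nonneg _), sq_abs] at h
  have hle : d ≤ √2 := by
    by_contra! hlt
    have h := hgap_two hlt.le a₀ c₀ ha₀ ha₀' hc₀ hc₀'
    have h' := hmin _ (hdist a₀ c₀ ha₀ ha₀' hc₀ hc₀')
    rw [← Real.sqrt_sq_eq_abs, h] at h'
    exact absurd h' (not_le.2 hlt)
  refine ⟨d, ⟨hd, fun _ h => hmin _ h⟩, hle, fun hG => ⟨fun hd2 => ?_, ?_⟩⟩
  · obtain ⟨hdeg, hcube⟩ := degree_eq_one_and_cube_of_gap_sq_eq_two hne (hi.not_adj hi') horth heig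
      hpm (hgap_two hd2.ge)
    refine iso_pathGraph_three_of_cube hG hdeg fun u => ?_
    -- Spectrally, A³e_i = 2Ae_i is θ³ = 2θ on the basis vectors that do not vanish at `i`.
    rw [← sum_eigenvalue_pow_mul horth heig, ← pow_one (G.adjMatrix ℝ),
      ← sum_eigenvalue_pow_mul horth heig, Finset.mul_sum]
    refine Finset.sum_congr rfl fun a _ => ?_
    by_cases ha : b a i = 0
    · simp [ha]
    · rw [hcube a ha]; ring
  · rintro ⟨e⟩
    refine le_antisymm hle ?_
    obtain ⟨s, hs, t, ht, hst, rfl⟩ := hd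
    have hroot : ∀ r ∈ eigenvalueSupport G i, r ^ 3 = 2 * r := by
      rintro r ⟨hr, -⟩
      obtain ⟨y, hy, hy0⟩ := hr.exists_hasEigenvector
      exact cube_eq_of_iso_pathGraph_three e (mem_eigenspace_adjOp_iff.1 hy)
        fun h => hy0 ((WithLp.ofLp_injective 2) h)
    exact sqrt_two_le_abs_sub (hroot s hs) (hroot t ht) hst
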